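/- Let $n\ge 1$ and let $\Omega\subset\mathbb R^n$ be an open, bounded, strictly convex domain with smooth boundary and $0\in\Omega$. Let \[\mathcal C_0=\{u\in C^\infty(\overline\Omega): D^2u>0 \text{ in }\Omega,\ u|_{\partial\Omega}=0\},\] and for $u\in\mathcal C_0$ put $u^\star(x)=\langle x,\nabla u(x)\rangle-u(x)$. For a real number $k\ge 0$ define \[H_{n+k}(u)=\frac1{n+k+1}\int_\Omega (u^\star)^k(-u)\det D^2u\,dx,\qquad \|u\|_{H_{n+k}}=\big[H_{n+k}(u)\big]^{\frac1{n+k+1}} .\] Then for all $u,v\in\mathcal C_0$ the triangle inequality holds: \[\|u+v\|_{H_{n+k}}\le\|u\|_{H_{n+k}}+\|v\|_{H_{n+k}} .\] -/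

import Mathlib

open scoped ContDiff

namespace GenMA

noncomputable section

/-- `Ω ⊆ ℝⁿ` is a bounded open set, with smooth boundary and strictly convex, that contains the
origin. Strict convexity is asked of the closure: every convex open set is trivially
`StrictConvex`. -/
structure IsAdmissibleDomain {n : ℕ} (Ω : Set (EuclideanSpace ℝ (Fin n))) : Prop where
  isOpen : IsOpen Ω
  isBounded : Bornology.IsBounded Ω
  zero_mem : (0 : EuclideanSpace ℝ (Fin n)) ∈ Ω
  convex : Convex ℝ Ω
  strictConvex : StrictConvex ℝ (closure Ω)
  /-- Near each boundary point, `Ω` is the sublevel set of a smooth local defining function whose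
  differential does not vanish at that point. -/
  smooth_boundary : ∀ p ∈ frontier Ω,
    ∃ (U : Set (EuclideanSpace ℝ (Fin n))) (ρ : EuclideanSpace ℝ (Fin n) → ℝ),
      IsOpen U ∧ p ∈ U ∧ ContDiffOn ℝ ∞ ρ U ∧ fderiv ℝ ρ p ≠ 0 ∧ ∀ x ∈ U, (x ∈ Ω ↔ ρ x < 0)

/-- The Hessian matrix `D²u(x)`, with entries `∂ᵢ∂ⱼu(x)`. -/
def hessian {n : ℕ} (u : EuclideanSpace ℝ (Fin n) → ℝ) (x : EuclideanSpace ℝ (Fin n)) :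
    Matrix (Fin n) (Fin n) ℝ :=
  Matrix.of fun i j =>
    fderiv ℝ (fderiv ℝ u) x (EuclideanSpace.single i 1) (EuclideanSpace.single j 1)

/-- The space `𝒞₀` of functions `u ∈ C^∞(Ω̄)` with `D²u > 0` and `u = 0` on `∂Ω`. Values of `u`
outside the closure of `Ω` are irrelevant. Positivity of the Hessian is only required in the
interior, so functions with `D²u > 0` up to the boundary are included. -/
def C0 {n : ℕ} (Ω : Set (EuclideanSpace ℝ (Fin n))) : Set (EuclideanSpace ℝ (Fin n) → ℝ) :=
  {u | ContDiffOn ℝ ∞ u (closure Ω) ∧ (∀ x ∈ Ω, (hessian u x).PosDef) ∧ ∀ x ∈ frontier Ω, u x = 0}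

/-- `u⋆(x) = ⟨x, ∇u(x)⟩ - u(x)`: the Legendre transform of `u` at the point `∇u(x)`. -/
def ustar {n : ℕ} (u : EuclideanSpace ℝ (Fin n) → ℝ) (x : EuclideanSpace ℝ (Fin n)) : ℝ :=
  inner ℝ x (gradient u x) - u x

/-- The generalized Monge–Ampère functional
`H_{n+k}(u) = (n+k+1)⁻¹ ∫_Ω (u⋆)ᵏ (-u) det D²u`. -/
def H {n : ℕ} (Ω : Set (EuclideanSpace ℝ (Fin n))) (k : ℝ)
    (u : EuclideanSpace ℝ (Fin n) → ℝ) : ℝ :=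
  1 / ((n : ℝ) + k + 1) * ∫ x in Ω, ustar u x ^ k * (-u x) * (hessian u x).det

/-- `‖u‖_{H_{n+k}} = H_{n+k}(u)^{1/(n+k+1)}`. -/
def normH {n : ℕ} (Ω : Set (EuclideanSpace ℝ (Fin n))) (k : ℝ)
    (u : EuclideanSpace ℝ (Fin n) → ℝ) : ℝ :=
  H Ω k u ^ (1 / ((n : ℝ) + k + 1))

end

end GenMA

namespace GenMA

open Set MeasureTheory Topology
open scoped RealInnerProductSpace ENNReal

variable {n : ℕ} {Ω : Set (EuclideanSpace ℝ (Fin n))} {u v : EuclideanSpace ℝ (Fin n) → ℝ}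

/-! The functional becomes an `L^p` norm, with `p = n + k + 1`, after the change of variables `z =
∇u(x) / u⋆(x)`. This map sends `Ω` bijectively onto the open polar body of `Ω`, which does not
depend on `u`, and its Jacobian is `(u⋆)^{-(n+1)} (-u) det D²u` (`det_polarMapDeriv`,
`C0.polarMap_injOn`, `C0.image_polarMap`). In the new variable `u⋆` becomes `R_u(z) = sup_x (-u(x))
/ (1 - ⟪x, z⟫)` (`C0.radial_polarMap`), so `p · H` is the integral of `R_u ^ p` over the polar body.
As a supremum of expressions linear in `u`, `R_u` is subadditive in `u` (`radial_add_le`), and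
Minkowski's inequality finishes the proof. -/

/-! ### Convexity and signs of functions in `C0`. -/

theorem fderiv_fderiv_eq_hessian (u : EuclideanSpace ℝ (Fin n) → ℝ)
    (x h : EuclideanSpace ℝ (Fin n)) :
    fderiv ℝ (fderiv ℝ u) x h h = (h : Fin n → ℝ) ⬝ᵥ (hessian u x).mulVec h := by
  have hh : h = ∑ i, h i • EuclideanSpace.single i (1 : ℝ) := by
    ext j; simp [Finset.sum_apply, Pi.single_apply]
  conv_lhs => rw [hh]
  simp only [map_sum, map_smul, sum_apply, smul_apply,
    smul_eq_mul, dotProduct, Matrix.mulVec, hessian, Matrix.of_apply, Finset.mul_sum]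
  rw [Finset.sum_comm]
  refine Finset.sum_congr rfl fun i _ => Finset.sum_congr rfl fun j _ => ?_
  ring

theorem fderiv_fderiv_pos {x h : EuclideanSpace ℝ (Fin n)} (hx : (hessian u x).PosDef)
    (hh : h ≠ 0) : 0 < fderiv ℝ (fderiv ℝ u) x h h := by
  rw [fderiv_fderiv_eq_hessian]
  have := hx.dotProduct_mulVec_pos (x := (h : Fin n → ℝ)) (by
    intro h0; apply hh; ext i; simpa using congrFun h0 i)
  simpa using this

theorem C0.contDiffAt (hΩ : IsAdmissibleDomain Ω) (hu : u ∈ C0 Ω)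
    {x : EuclideanSpace ℝ (Fin n)} (hx : x ∈ Ω) : ContDiffAt ℝ ∞ u x :=
  hu.1.contDiffAt (Filter.mem_of_superset (hΩ.isOpen.mem_nhds hx) subset_closure)

theorem C0.hasFDerivAt (hΩ : IsAdmissibleDomain Ω) (hu : u ∈ C0 Ω)
    {x : EuclideanSpace ℝ (Fin n)} (hx : x ∈ Ω) : HasFDerivAt u (fderiv ℝ u x) x :=
  ((C0.contDiffAt hΩ hu hx).differentiableAt (by simp)).hasFDerivAt

theorem C0.hasFDerivAt_fderiv (hΩ : IsAdmissibleDomain Ω) (hu : u ∈ C0 Ω)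
    {x : EuclideanSpace ℝ (Fin n)} (hx : x ∈ Ω) :
    HasFDerivAt (fderiv ℝ u) (fderiv ℝ (fderiv ℝ u) x) x :=
  (((C0.contDiffAt hΩ hu hx).fderiv_right (m := 1) (by norm_cast)).differentiableAt
    (by simp)).hasFDerivAt

theorem IsAdmissibleDomain.isCompact_closure (hΩ : IsAdmissibleDomain Ω) :
    IsCompact (closure Ω) :=
  hΩ.isBounded.isCompact_closure

theorem IsAdmissibleDomain.add_smul_sub_mem (hΩ : IsAdmissibleDomain Ω)
    {x y : EuclideanSpace ℝ (Fin n)} (hx : x ∈ Ω) (hy : y ∈ closure Ω) {t : ℝ} (ht : t ∈ Ico 0 1) :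
    x + t • (y - x) ∈ Ω := by
  have := hΩ.convex.combo_interior_closure_mem_interior (x := x) (y := y) (a := 1 - t) (b := t)
    (by rwa [hΩ.isOpen.interior_eq]) hy (by linarith [ht.2]) ht.1 (by ring)
  rw [hΩ.isOpen.interior_eq] at this
  convert this using 1
  module

/-- The graph of `u` lies strictly above its tangent planes. -/
theorem C0.tangent_lt (hΩ : IsAdmissibleDomain Ω) (hu : u ∈ C0 Ω)
    {x y : EuclideanSpace ℝ (Fin n)} (hx : x ∈ Ω) (hy : y ∈ closure Ω) (hxy : y ≠ x) :
    u x + fderiv ℝ u x (y - x) < u y := by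
  obtain ⟨h, rfl⟩ : ∃ h, y = x + h := ⟨y - x, by simp⟩
  have h0 : h ≠ 0 := by simpa using hxy
  have hl : ∀ t : ℝ, HasDerivAt (fun t : ℝ => x + t • h) h t := fun t => by
    simpa using ((hasDerivAt_id t).smul_const h).const_add x
  have hmem : ∀ t ∈ Ico (0 : ℝ) 1, x + t • h ∈ Ω := fun t ht => by
    simpa using hΩ.add_smul_sub_mem hx hy ht
  have hd1 : ∀ t ∈ Ico (0 : ℝ) 1,
      HasDerivAt (fun t => u (x + t • h)) (fderiv ℝ u (x + t • h) h) t := fun t ht =>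
    (C0.hasFDerivAt hΩ hu (hmem t ht)).comp_hasDerivAt t (hl t)
  have hd2 : ∀ t ∈ Ico (0 : ℝ) 1, HasDerivAt (fun t => fderiv ℝ u (x + t • h) h)
      (fderiv ℝ (fderiv ℝ u) (x + t • h) h h) t := fun t ht => by
    have h2 : HasDerivAt (fun t => fderiv ℝ u (x + t • h))
        (fderiv ℝ (fderiv ℝ u) (x + t • h) h) t :=
      (C0.hasFDerivAt_fderiv hΩ hu (hmem t ht)).comp_hasDerivAt t (hl t)
    simpa using h2.clm_apply (hasDerivAt_const t h)
  -- The endpoint `t = 1` is left out: `y` may lie on the boundary, where `fderiv` carries no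
  -- information.
  have hmono : StrictMonoOn (fun t => fderiv ℝ u (x + t • h) h) (Ico (0 : ℝ) 1) := by
    refine strictMonoOn_of_deriv_pos (convex_Ico 0 1)
      (fun t ht => (hd2 t ht).continuousAt.continuousWithinAt) fun t ht => ?_
    have ht' := interior_subset ht
    rw [(hd2 t ht').deriv]
    exact fderiv_fderiv_pos (hu.2.1 _ (hmem t ht')) h0
  have hcont : ContinuousOn (fun t : ℝ => u (x + t • h)) (Icc 0 1) := by
    refine hu.1.continuousOn.comp (by fun_prop) fun t ht => ?_
    rcases eq_or_lt_of_le ht.2 with rfl | h1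
    · simpa using hy
    · exact subset_closure (hmem t ⟨ht.1, h1⟩)
  obtain ⟨c, hc, hc'⟩ := exists_hasDerivAt_eq_slope (fun t => u (x + t • h))
    (fun t => fderiv ℝ u (x + t • h) h) one_pos hcont fun t ht => hd1 t ⟨ht.1.le, ht.2⟩
  have hlt := hmono (left_mem_Ico.2 one_pos) ⟨hc.1.le, hc.2⟩ hc.1
  simp only [hc', zero_smul, add_zero, one_smul, sub_zero, div_one] at hlt
  rw [add_sub_cancel_left]
  linarith

theorem C0.tangent_le (hΩ : IsAdmissibleDomain Ω) (hu : u ∈ C0 Ω)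
    {x y : EuclideanSpace ℝ (Fin n)} (hx : x ∈ Ω) (hy : y ∈ closure Ω) :
    u x + fderiv ℝ u x (y - x) ≤ u y := by
  rcases eq_or_ne y x with rfl | h
  · simp
  · exact (C0.tangent_lt hΩ hu hx hy h).le

theorem IsAdmissibleDomain.exists_ne (hn : 1 ≤ n) (hΩ : IsAdmissibleDomain Ω)
    (x : EuclideanSpace ℝ (Fin n)) : ∃ y ∈ Ω, y ≠ x := by
  have : Nonempty (Fin n) := ⟨⟨0, hn⟩⟩
  by_contra! h
  have hs : Ω = {x} := eq_singleton_iff_unique_mem.2 ⟨h 0 hΩ.zero_mem ▸ hΩ.zero_mem, h⟩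
  exact not_isOpen_singleton x (hs ▸ hΩ.isOpen)

/-- Maximum principle: at an interior maximum the tangent plane is horizontal, yet the graph lies
strictly above it at other points. -/
theorem C0.neg (hn : 1 ≤ n) (hΩ : IsAdmissibleDomain Ω) (hu : u ∈ C0 Ω)
    {x : EuclideanSpace ℝ (Fin n)} (hx : x ∈ Ω) : u x < 0 := by
  by_contra! h0
  obtain ⟨m, hm, hmax⟩ := hΩ.isCompact_closure.exists_isMaxOn ⟨x, subset_closure hx⟩
    hu.1.continuousOn
  obtain ⟨p, hp, hpmax⟩ : ∃ p ∈ Ω, IsMaxOn u (closure Ω) p := by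
    by_cases hmΩ : m ∈ Ω
    · exact ⟨m, hmΩ, hmax⟩
    · refine ⟨x, hx, fun y hy => ?_⟩
      have : m ∈ frontier Ω := ⟨hm, by rwa [hΩ.isOpen.interior_eq]⟩
      exact (hmax hy).trans ((hu.2.2 m this).le.trans h0)
  obtain ⟨y, hy, hyp⟩ := hΩ.exists_ne hn p
  have hloc : IsLocalMax u p :=
    hpmax.isLocalMax (Filter.mem_of_superset (hΩ.isOpen.mem_nhds hp) subset_closure)
  have := C0.tangent_lt hΩ hu hp (subset_closure hy) hyp
  rw [hloc.fderiv_eq_zero] at this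
  have h2 : u y ≤ u p := hpmax (subset_closure hy)
  simp at this
  linarith

theorem inner_gradient (u : EuclideanSpace ℝ (Fin n) → ℝ) (x y : EuclideanSpace ℝ (Fin n)) :
    ⟪y, gradient u x⟫ = fderiv ℝ u x y := by
  rw [real_inner_comm, gradient, InnerProductSpace.toDual_symm_apply]

theorem ustar_eq (u : EuclideanSpace ℝ (Fin n) → ℝ) (x : EuclideanSpace ℝ (Fin n)) :
    ustar u x = fderiv ℝ u x x - u x := by
  rw [ustar, inner_gradient]

theorem C0.ustar_pos (hn : 1 ≤ n) (hΩ : IsAdmissibleDomain Ω) (hu : u ∈ C0 Ω)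
    {x : EuclideanSpace ℝ (Fin n)} (hx : x ∈ Ω) : 0 < ustar u x := by
  have h1 := C0.tangent_le hΩ hu hx (subset_closure hΩ.zero_mem)
  have h2 := C0.neg hn hΩ hu hΩ.zero_mem
  rw [ustar_eq]
  simp at h1
  linarith

/-- `u⋆(x)` majorises the affine function `⟨y, ∇u(x)⟩ - u(y)` of the competitors `y`. -/
theorem C0.fderiv_sub_le_ustar (hΩ : IsAdmissibleDomain Ω) (hu : u ∈ C0 Ω)
    {x y : EuclideanSpace ℝ (Fin n)} (hx : x ∈ Ω) (hy : y ∈ closure Ω) :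
    fderiv ℝ u x y - u y ≤ ustar u x := by
  have h1 := C0.tangent_le hΩ hu hx hy
  rw [ustar_eq]
  rw [map_sub] at h1
  linarith

theorem C0.add (hΩ : IsAdmissibleDomain Ω) (hu : u ∈ C0 Ω) (hv : v ∈ C0 Ω) : u + v ∈ C0 Ω := by
  refine ⟨hu.1.add hv.1, fun x hx => ?_, fun x hx => by simp [hu.2.2 x hx, hv.2.2 x hx]⟩
  have hE : fderiv ℝ (u + v) =ᶠ[𝓝 x] fderiv ℝ u + fderiv ℝ v := by
    filter_upwards [hΩ.isOpen.mem_nhds hx] with y hy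
    exact ((C0.hasFDerivAt hΩ hu hy).add (C0.hasFDerivAt hΩ hv hy)).fderiv
  have hh : hessian (u + v) x = hessian u x + hessian v x := by
    ext i j
    simp only [hessian, Matrix.of_apply, Matrix.add_apply]
    rw [hE.fderiv_eq,
      ((C0.hasFDerivAt_fderiv hΩ hu hx).add (C0.hasFDerivAt_fderiv hΩ hv hx)).fderiv]
    simp
  rw [hh]
  exact (hu.2.1 x hx).add (hv.2.1 x hx)

/-! ### The change of variables and its Jacobian. -/

noncomputable section

/-- The inverse of the Riesz isomorphism, as an `ℝ`-linear map. -/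
def rieszInv (n : ℕ) :
    StrongDual ℝ (EuclideanSpace ℝ (Fin n)) →L[ℝ] EuclideanSpace ℝ (Fin n) :=
  LinearMap.toContinuousLinearMap
    { toFun := (InnerProductSpace.toDual ℝ (EuclideanSpace ℝ (Fin n))).symm
      map_add' := map_add _
      map_smul' := fun c f => by simp }

/-- The Hessian of `u` at `x` as an endomorphism of `ℝⁿ`: the derivative of the gradient. -/
def hessianMap (u : EuclideanSpace ℝ (Fin n) → ℝ) (x : EuclideanSpace ℝ (Fin n)) :
    EuclideanSpace ℝ (Fin n) →L[ℝ] EuclideanSpace ℝ (Fin n) :=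
  (rieszInv n).comp (fderiv ℝ (fderiv ℝ u) x)

theorem inner_hessianMap (x h y : EuclideanSpace ℝ (Fin n)) :
    ⟪y, hessianMap u x h⟫ = fderiv ℝ (fderiv ℝ u) x h y := by
  rw [real_inner_comm]
  exact InnerProductSpace.toDual_symm_apply (𝕜 := ℝ)

theorem det_hessianMap (u : EuclideanSpace ℝ (Fin n) → ℝ) (x : EuclideanSpace ℝ (Fin n)) :
    LinearMap.det (hessianMap u x : EuclideanSpace ℝ (Fin n) →ₗ[ℝ] EuclideanSpace ℝ (Fin n)) =
      (hessian u x).det := by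
  -- Transposing matches the index order of `hessian`, so symmetry of second derivatives is not
  -- needed.
  rw [← LinearMap.det_toMatrix (EuclideanSpace.basisFun (Fin n) ℝ).toBasis, ← Matrix.det_transpose]
  congr 1
  ext i j
  rw [Matrix.transpose_apply, LinearMap.toMatrix_apply]
  simp only [OrthonormalBasis.coe_toBasis, OrthonormalBasis.coe_toBasis_repr_apply,
    OrthonormalBasis.repr_apply_apply, EuclideanSpace.basisFun_apply, hessian, Matrix.of_apply]
  exact inner_hessianMap _ _ _

theorem C0.hasFDerivAt_gradient (hΩ : IsAdmissibleDomain Ω) (hu : u ∈ C0 Ω)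
    {x : EuclideanSpace ℝ (Fin n)} (hx : x ∈ Ω) :
    HasFDerivAt (gradient u) (hessianMap u x) x :=
  (rieszInv n).hasFDerivAt.comp x (C0.hasFDerivAt_fderiv hΩ hu hx)

theorem C0.hasFDerivAt_ustar (hΩ : IsAdmissibleDomain Ω) (hu : u ∈ C0 Ω)
    {x : EuclideanSpace ℝ (Fin n)} (hx : x ∈ Ω) :
    HasFDerivAt (ustar u) ((innerSL ℝ x).comp (hessianMap u x)) x := by
  have h := ((C0.hasFDerivAt_fderiv hΩ hu hx).clm_apply (hasFDerivAt_id x)).sub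
    (C0.hasFDerivAt hΩ hu hx)
  refine (h.congr_of_eventuallyEq (.of_forall fun y => ?_)).congr_fderiv ?_
  · simp [ustar_eq]
  · ext h
    simp [inner_hessianMap]

/-- The map `x ↦ ∇u(x) / u⋆(x)`: the direction, in the chart `(z, 1)`, of the point
`(∇u(x), u⋆(x))` on the graph of the Legendre transform of `u`. -/
def polarMap (u : EuclideanSpace ℝ (Fin n) → ℝ) (x : EuclideanSpace ℝ (Fin n)) :
    EuclideanSpace ℝ (Fin n) :=
  (ustar u x)⁻¹ • gradient u x

/-- The derivative of `polarMap`. -/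
def polarMapDeriv (u : EuclideanSpace ℝ (Fin n) → ℝ) (x : EuclideanSpace ℝ (Fin n)) :
    EuclideanSpace ℝ (Fin n) →L[ℝ] EuclideanSpace ℝ (Fin n) :=
  (ustar u x)⁻¹ • hessianMap u x +
    (-((ustar u x ^ 2)⁻¹) • (innerSL ℝ x).comp (hessianMap u x)).smulRight (gradient u x)

theorem C0.hasFDerivAt_polarMap (hn : 1 ≤ n) (hΩ : IsAdmissibleDomain Ω) (hu : u ∈ C0 Ω)
    {x : EuclideanSpace ℝ (Fin n)} (hx : x ∈ Ω) :
    HasFDerivAt (polarMap u) (polarMapDeriv u x) x :=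
  ((hasDerivAt_inv (C0.ustar_pos hn hΩ hu hx).ne').comp_hasFDerivAt x
    (C0.hasFDerivAt_ustar hΩ hu hx)).smul (C0.hasFDerivAt_gradient hΩ hu hx)

/-- The derivative is `(u⋆)⁻¹ (I - (u⋆)⁻¹ ∇u ⊗ x) D²u`. The rank-one perturbation has determinant `1
- ⟪x, ∇u⟫ / u⋆ = -u / u⋆`, and the scalar contributes `n` further factors `(u⋆)⁻¹`. -/
theorem det_polarMapDeriv {x : EuclideanSpace ℝ (Fin n)} (hx : ustar u x ≠ 0) :
    (polarMapDeriv u x).det = (ustar u x ^ (n + 1))⁻¹ * (-u x * (hessian u x).det) := by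
  set g := gradient u x with hg
  have hfact : (polarMapDeriv u x : EuclideanSpace ℝ (Fin n) →ₗ[ℝ] EuclideanSpace ℝ (Fin n)) =
      (ustar u x)⁻¹ • (LinearMap.transvection
        (innerSL ℝ x : EuclideanSpace ℝ (Fin n) →ₗ[ℝ] ℝ) (-(ustar u x)⁻¹ • g) ∘ₗ
        (hessianMap u x : EuclideanSpace ℝ (Fin n) →ₗ[ℝ] EuclideanSpace ℝ (Fin n))) := by
    ext1 h
    simp only [polarMapDeriv, ContinuousLinearMap.coe_coe, add_apply,
      ContinuousLinearMap.smulRight_apply, smul_apply,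
      ContinuousLinearMap.comp_apply, LinearMap.smul_apply, LinearMap.comp_apply,
      LinearMap.transvection.apply, smul_add, smul_smul, smul_eq_mul, ← hg]
    congr 2
    field_simp
  have h1 : 1 + (innerSL ℝ x) (-(ustar u x)⁻¹ • g) = -u x * (ustar u x)⁻¹ := by
    have : ⟪x, g⟫ = ustar u x + u x := by rw [ustar]; ring
    rw [map_smul, innerSL_apply_apply, this]
    simp only [smul_eq_mul]
    field_simp
    ring
  rw [ContinuousLinearMap.det, hfact, LinearMap.det_smul, LinearMap.det_comp,
    LinearMap.transvection.det, det_hessianMap, ContinuousLinearMap.coe_coe, h1,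
    finrank_euclideanSpace_fin, pow_succ, mul_inv, inv_pow]
  ring

/-! ### Bijectivity onto the open polar body. -/

theorem C0.polarMap_injOn (hn : 1 ≤ n) (hΩ : IsAdmissibleDomain Ω) (hu : u ∈ C0 Ω) :
    InjOn (polarMap u) Ω := by
  have hgrad : ∀ x ∈ Ω, ∀ y, fderiv ℝ u x y = ustar u x * ⟪y, polarMap u x⟫ := fun x hx y => by
    rw [polarMap, real_inner_smul_right, inner_gradient, ← mul_assoc,
      mul_inv_cancel₀ (C0.ustar_pos hn hΩ hu hx).ne', one_mul]
  -- With `z` the common image, `-u x = u⋆(x) (1 - ⟪x, z⟫)`, and the tangent plane at `y` bounds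
  -- this by `u⋆(y) (1 - ⟪x, z⟫)`; the common factor is positive.
  have key : ∀ x ∈ Ω, ∀ y ∈ Ω, polarMap u x = polarMap u y → ustar u x ≤ ustar u y := by
    intro x hx y hy h
    have h1 := C0.fderiv_sub_le_ustar hΩ hu hy (subset_closure hx)
    have h2 := ustar_eq u x
    have h3 := C0.neg hn hΩ hu hx
    have hr := C0.ustar_pos hn hΩ hu hx
    rw [hgrad y hy, ← h] at h1
    rw [hgrad x hx] at h2
    have h4 : ⟪x, polarMap u x⟫ < 1 := by
      by_contra! h5
      nlinarith
    nlinarith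
  intro x hx y hy h
  by_contra! hxy
  have hr : ustar u x = ustar u y := (key x hx y hy h).antisymm (key y hy x hx h.symm)
  have hd : ∀ z, fderiv ℝ u x z = fderiv ℝ u y z := fun z => by
    rw [hgrad x hx, hgrad y hy, hr, h]
  have h1 := C0.tangent_lt hΩ hu hx (subset_closure hy) (Ne.symm hxy)
  have h2 := ustar_eq u x
  have h3 := ustar_eq u y
  rw [map_sub, hd y] at h1
  linarith

/-- The interior of the polar body of `Ω`. -/
def openPolar (Ω : Set (EuclideanSpace ℝ (Fin n))) : Set (EuclideanSpace ℝ (Fin n)) :=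
  {z | ∀ x ∈ closure Ω, ⟪x, z⟫ < 1}

theorem C0.image_polarMap (hn : 1 ≤ n) (hΩ : IsAdmissibleDomain Ω) (hu : u ∈ C0 Ω) :
    polarMap u '' Ω = openPolar Ω := by
  refine Subset.antisymm ?_ fun z hz => ?_
  · rintro _ ⟨x, hx, rfl⟩ y hy
    have hr := C0.ustar_pos hn hΩ hu hx
    rw [polarMap, real_inner_smul_right, inner_gradient, inv_mul_lt_one₀ hr, ustar_eq]
    have hux := C0.neg hn hΩ hu hx
    rcases eq_or_ne y x with rfl | hyx
    · linarith
    have h := C0.tangent_lt hΩ hu hx hy hyx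
    rw [map_sub] at h
    have huy : u y ≤ 0 := by
      by_cases hyΩ : y ∈ Ω
      · exact (C0.neg hn hΩ hu hyΩ).le
      · exact (hu.2.2 y ⟨hy, by rwa [hΩ.isOpen.interior_eq]⟩).le
    linarith
  -- The preimage of `z` is a maximiser of the quotient defining `radial`. It is interior because
  -- the maximum `r` is positive, and the first-order condition there reads `∇u(x) = r z`, whence
  -- `u⋆(x) = r`.
  · have hpos : ∀ x ∈ closure Ω, 0 < 1 - ⟪x, z⟫ := fun x hx => sub_pos.2 (hz x hx)
    obtain ⟨x, hx, hmax⟩ := hΩ.isCompact_closure.exists_isMaxOn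
      (f := fun x => -u x / (1 - ⟪x, z⟫)) ⟨0, subset_closure hΩ.zero_mem⟩
      (hu.1.continuousOn.neg.div (by fun_prop) fun x hx => (hpos x hx).ne')
    set r := -u x / (1 - ⟪x, z⟫) with hr
    have hr0 : 0 < r := by
      have h0 : -u 0 / (1 - ⟪(0 : EuclideanSpace ℝ (Fin n)), z⟫) ≤ r :=
        hmax (subset_closure hΩ.zero_mem)
      have := C0.neg hn hΩ hu hΩ.zero_mem
      simp at h0
      linarith
    have hxr : -u x = r * (1 - ⟪x, z⟫) := by
      rw [hr, div_mul_cancel₀ _ (hpos x hx).ne']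
    have hxΩ : x ∈ Ω := by
      by_contra h
      have : u x = 0 := hu.2.2 x ⟨hx, by rwa [hΩ.isOpen.interior_eq]⟩
      rw [hr, this] at hr0
      simp at hr0
    have hloc : IsLocalMax (fun y => r * ⟪z, y⟫ - u y) x := by
      filter_upwards [hΩ.isOpen.mem_nhds hxΩ] with y hy
      have h1 : -u y / (1 - ⟪y, z⟫) ≤ r := hmax (subset_closure hy)
      rw [div_le_iff₀ (hpos y (subset_closure hy))] at h1
      rw [real_inner_comm, real_inner_comm x z]
      linarith
    have hd : HasFDerivAt (fun y => r * ⟪z, y⟫ - u y) (r • innerSL ℝ z - fderiv ℝ u x) x :=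
      ((innerSL ℝ z).hasFDerivAt.const_mul r).sub (C0.hasFDerivAt hΩ hu hxΩ)
    have hgrad : ∀ y, fderiv ℝ u x y = r * ⟪z, y⟫ := fun y => by
      have := congrArg (fun L => L y) (hloc.hasFDerivAt_eq_zero hd)
      simp at this
      linarith
    have hus : ustar u x = r := by
      rw [ustar_eq, hgrad, real_inner_comm]
      linarith
    refine ⟨x, hxΩ, ?_⟩
    refine ext_inner_left ℝ fun y => ?_
    rw [polarMap, real_inner_smul_right, inner_gradient, hus, hgrad, real_inner_comm,
      inv_mul_cancel_left₀ hr0.ne']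

/-! ### The radial function. -/

/-- The radial function, in the chart `(z, 1)`, of the epigraph of the Legendre transform of `u`:
the least `r` with `u⋆(r z) ≤ r`. -/
def radial (Ω : Set (EuclideanSpace ℝ (Fin n))) (u : EuclideanSpace ℝ (Fin n) → ℝ)
    (z : EuclideanSpace ℝ (Fin n)) : ℝ≥0∞ :=
  ⨆ x ∈ Ω, ENNReal.ofReal (-u x) / ENNReal.ofReal (1 - ⟪x, z⟫)

/-- The supremum is uncountable, so measurability goes through lower semicontinuity. -/
theorem measurable_radial (Ω : Set (EuclideanSpace ℝ (Fin n)))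
    (u : EuclideanSpace ℝ (Fin n) → ℝ) : Measurable (radial Ω u) := by
  refine (lowerSemicontinuous_biSup fun x _ => Continuous.lowerSemicontinuous ?_).measurable
  simp only [div_eq_mul_inv]
  exact (ENNReal.continuous_const_mul ENNReal.ofReal_ne_top).comp
    (continuous_inv.comp (ENNReal.continuous_ofReal.comp (by fun_prop)))

theorem radial_add_le (hn : 1 ≤ n) (hΩ : IsAdmissibleDomain Ω) (hu : u ∈ C0 Ω) (hv : v ∈ C0 Ω)
    (z : EuclideanSpace ℝ (Fin n)) : radial Ω (u + v) z ≤ radial Ω u z + radial Ω v z := by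
  refine iSup₂_le fun x hx => ?_
  rw [Pi.add_apply, neg_add, ENNReal.ofReal_add (neg_nonneg.2 (C0.neg hn hΩ hu hx).le)
    (neg_nonneg.2 (C0.neg hn hΩ hv hx).le), ENNReal.add_div]
  exact add_le_add (le_iSup₂_of_le x hx le_rfl) (le_iSup₂_of_le x hx le_rfl)

/-- The tangent plane inequality at `x` says exactly that the supremum is attained at `x`. -/
theorem C0.radial_polarMap (hn : 1 ≤ n) (hΩ : IsAdmissibleDomain Ω) (hu : u ∈ C0 Ω)
    {x : EuclideanSpace ℝ (Fin n)} (hx : x ∈ Ω) :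
    radial Ω u (polarMap u x) = ENNReal.ofReal (ustar u x) := by
  have hr := C0.ustar_pos hn hΩ hu hx
  have hinner : ∀ y, ⟪y, polarMap u x⟫ = (ustar u x)⁻¹ * fderiv ℝ u x y := fun y => by
    rw [polarMap, real_inner_smul_right, inner_gradient]
  have hpos : ∀ y ∈ Ω, 0 < 1 - ⟪y, polarMap u x⟫ := fun y hy => by
    have h : polarMap u x ∈ openPolar Ω := C0.image_polarMap hn hΩ hu ▸ mem_image_of_mem _ hx
    exact sub_pos.2 (h y (subset_closure hy))
  refine le_antisymm (iSup₂_le fun y hy => ?_) (le_iSup₂_of_le x hx ?_)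
  · rw [← ENNReal.ofReal_div_of_pos (hpos y hy)]
    refine ENNReal.ofReal_le_ofReal ?_
    rw [div_le_iff₀ (hpos y hy), hinner, mul_sub, mul_inv_cancel_left₀ hr.ne']
    linarith [C0.fderiv_sub_le_ustar hΩ hu hx (subset_closure hy)]
  · rw [← ENNReal.ofReal_div_of_pos (hpos x hx)]
    refine ENNReal.ofReal_le_ofReal ?_
    rw [le_div_iff₀ (hpos x hx), hinner, mul_sub, mul_inv_cancel_left₀ hr.ne']
    linarith [ustar_eq u x]

/-! ### Finiteness and the integral formula. -/

theorem IsAdmissibleDomain.volume_openPolar_lt_top (hΩ : IsAdmissibleDomain Ω) :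
    volume (openPolar Ω) < ⊤ := by
  obtain ⟨ε, hε, hball⟩ := Metric.isOpen_iff.1 hΩ.isOpen 0 hΩ.zero_mem
  refine ((Metric.isBounded_closedBall (x := (0 : EuclideanSpace ℝ (Fin n)))
    (r := 2 / ε)).subset fun z hz => ?_).measure_lt_top
  rw [mem_closedBall_zero_iff]
  rcases eq_or_ne z 0 with rfl | hz0
  · simp; positivity
  have hzn : 0 < ‖z‖ := norm_pos_iff.2 hz0
  have hm : (ε / 2 * ‖z‖⁻¹) • z ∈ Ω := hball (by
    rw [mem_ball_zero_iff, norm_smul, Real.norm_of_nonneg (by positivity),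
      inv_mul_cancel_right₀ hzn.ne']
    linarith)
  have h1 := hz _ (subset_closure hm)
  rw [real_inner_smul_left, real_inner_self_eq_norm_sq] at h1
  rw [le_div_iff₀ hε]
  field_simp at h1
  linarith

/-- Smoothness up to the boundary enters here: `fderivWithin` on the compact closure is continuous
and agrees with `fderiv` on `Ω`. -/
theorem C0.exists_ustar_le (hΩ : IsAdmissibleDomain Ω) (hu : u ∈ C0 Ω) :
    ∃ C : ℝ, ∀ x ∈ Ω, ustar u x ≤ C := by
  have hcl : UniqueDiffOn ℝ (closure Ω) := uniqueDiffOn_convex hΩ.convex.closure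
    ⟨0, interior_mono subset_closure (by rw [hΩ.isOpen.interior_eq]; exact hΩ.zero_mem)⟩
  have hc : ContinuousOn (fun x => fderivWithin ℝ u (closure Ω) x x - u x) (closure Ω) :=
    ((hu.1.continuousOn_fderivWithin hcl (by simp)).clm_apply continuousOn_id).sub
      hu.1.continuousOn
  obtain ⟨C, hC⟩ := (hΩ.isCompact_closure.image_of_continuousOn hc).bddAbove
  refine ⟨C, fun x hx => ?_⟩
  have := hC (mem_image_of_mem _ (subset_closure hx))
  rwa [fderivWithin_of_mem_nhds
    (Filter.mem_of_superset (hΩ.isOpen.mem_nhds hx) subset_closure), ← ustar_eq] at this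

theorem C0.lintegral_radial_rpow (hn : 1 ≤ n) (hΩ : IsAdmissibleDomain Ω) (hu : u ∈ C0 Ω)
    (k : ℝ) (hk : 0 ≤ k) :
    ∫⁻ z in openPolar Ω, radial Ω u z ^ ((n : ℝ) + k + 1) =
      ∫⁻ x in Ω, ENNReal.ofReal (ustar u x ^ k * (-u x) * (hessian u x).det) := by
  rw [← C0.image_polarMap hn hΩ hu, lintegral_image_eq_lintegral_abs_det_fderiv_mul volume
    hΩ.isOpen.measurableSet
    (fun x hx => (C0.hasFDerivAt_polarMap hn hΩ hu hx).hasFDerivWithinAt)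
    (C0.polarMap_injOn hn hΩ hu)]
  refine setLIntegral_congr_fun hΩ.isOpen.measurableSet fun x hx => ?_
  have hr := C0.ustar_pos hn hΩ hu hx
  have hux := C0.neg hn hΩ hu hx
  have hdet := (hu.2.1 x hx).det_pos
  have hnn : 0 ≤ -u x * (hessian u x).det := mul_nonneg (by linarith) hdet.le
  rw [C0.radial_polarMap hn hΩ hu hx, det_polarMapDeriv hr.ne', abs_of_nonneg (by positivity),
    ENNReal.ofReal_rpow_of_nonneg hr.le (by positivity), ← ENNReal.ofReal_mul (by positivity)]
  congr 1
  have : ustar u x ^ ((n : ℝ) + k + 1) = ustar u x ^ k * ustar u x ^ (n + 1) := by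
    rw [← Real.rpow_natCast, ← Real.rpow_add hr]
    push_cast
    ring_nf
  rw [this]
  field_simp

theorem C0.lintegral_radial_rpow_lt_top (hn : 1 ≤ n) (hΩ : IsAdmissibleDomain Ω) (hu : u ∈ C0 Ω)
    {d : ℝ} (hd : 0 ≤ d) : ∫⁻ z in openPolar Ω, radial Ω u z ^ d < ⊤ := by
  obtain ⟨C, hC⟩ := C0.exists_ustar_le hΩ hu
  refine lt_of_le_of_lt (b := ∫⁻ _ in openPolar Ω, ENNReal.ofReal C ^ d) ?_ ?_
  · refine setLIntegral_mono measurable_const fun z hz => ENNReal.rpow_le_rpow ?_ hd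
    rw [← C0.image_polarMap hn hΩ hu] at hz
    obtain ⟨x, hx, rfl⟩ := hz
    rw [C0.radial_polarMap hn hΩ hu hx]
    exact ENNReal.ofReal_le_ofReal (hC x hx)
  · rw [setLIntegral_const]
    exact ENNReal.mul_lt_top (ENNReal.rpow_lt_top_of_nonneg hd ENNReal.ofReal_ne_top)
      hΩ.volume_openPolar_lt_top

theorem C0.continuousOn_det_hessian (hΩ : IsAdmissibleDomain Ω) (hu : u ∈ C0 Ω) :
    ContinuousOn (fun x => (hessian u x).det) Ω := by
  have h2 : ContinuousOn (fderiv ℝ (fderiv ℝ u)) Ω := fun x hx =>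
    ((((C0.contDiffAt hΩ hu hx).fderiv_right (m := 1) (by norm_cast)).fderiv_right (m := 0)
      (by norm_cast)).continuousAt).continuousWithinAt
  refine Continuous.comp_continuousOn (g := Matrix.det) (by fun_prop) ?_
  refine continuousOn_pi.2 fun i => continuousOn_pi.2 fun j => ?_
  exact (h2.clm_apply continuousOn_const).clm_apply continuousOn_const

theorem C0.H_eq (hn : 1 ≤ n) (hΩ : IsAdmissibleDomain Ω) (hu : u ∈ C0 Ω)
    {k : ℝ} (hk : 0 ≤ k) :
    H Ω k u = 1 / ((n : ℝ) + k + 1) *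
      (∫⁻ z in openPolar Ω, radial Ω u z ^ ((n : ℝ) + k + 1)).toReal := by
  have hus : ContinuousOn (ustar u) Ω := fun x hx =>
    (C0.hasFDerivAt_ustar hΩ hu hx).continuousAt.continuousWithinAt
  have hc : ContinuousOn (fun x => ustar u x ^ k * (-u x) * (hessian u x).det) Ω :=
    ((hus.rpow_const fun x hx => Or.inr hk).mul
      (hu.1.continuousOn.mono subset_closure).neg).mul (C0.continuousOn_det_hessian hΩ hu)
  rw [H, C0.lintegral_radial_rpow hn hΩ hu k hk, integral_eq_lintegral_of_nonneg_ae
    ((ae_restrict_iff' hΩ.isOpen.measurableSet).2 (.of_forall fun x hx => ?_))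
    (hc.aestronglyMeasurable hΩ.isOpen.measurableSet)]
  have hr := C0.ustar_pos hn hΩ hu hx
  have hux := C0.neg hn hΩ hu hx
  have hdet := (hu.2.1 x hx).det_pos
  exact mul_nonneg (mul_nonneg (by positivity) (by linarith)) hdet.le

/-- `‖u‖_{H_{n+k}}` is, up to a constant, the `L^{n+k+1}` norm of the radial function of `u`. -/
theorem C0.normH_eq (hn : 1 ≤ n) (hΩ : IsAdmissibleDomain Ω) (hu : u ∈ C0 Ω)
    {k : ℝ} (hk : 0 ≤ k) :
    normH Ω k u = (1 / ((n : ℝ) + k + 1)) ^ (1 / ((n : ℝ) + k + 1)) *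
      ((∫⁻ z in openPolar Ω, radial Ω u z ^ ((n : ℝ) + k + 1)) ^
        (1 / ((n : ℝ) + k + 1))).toReal := by
  rw [normH, C0.H_eq hn hΩ hu hk, Real.mul_rpow (by positivity) ENNReal.toReal_nonneg,
    ENNReal.toReal_rpow]

end

end GenMA

/-! ### Minkowski's inequality. -/

theorem mainTheorem8 (n : ℕ) (hn : 1 ≤ n) (Ω : Set (EuclideanSpace ℝ (Fin n)))
    (hΩ : GenMA.IsAdmissibleDomain Ω) (k : ℝ) (hk : 0 ≤ k)
    (u v : EuclideanSpace ℝ (Fin n) → ℝ) (hu : u ∈ GenMA.C0 Ω) (hv : v ∈ GenMA.C0 Ω) :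
    GenMA.normH Ω k (u + v) ≤ GenMA.normH Ω k u + GenMA.normH Ω k v := by
  have hd : (1 : ℝ) ≤ (n : ℝ) + k + 1 := by linarith [(Nat.cast_nonneg n : (0 : ℝ) ≤ n)]
  have hd0 : (0 : ℝ) ≤ 1 / ((n : ℝ) + k + 1) := by positivity
  -- Finiteness is essential: `toReal` sends `⊤` to `0`, so it is monotone and additive only on
  -- finite values.
  have hfin : ∀ w ∈ GenMA.C0 Ω,
      (∫⁻ z in GenMA.openPolar Ω, GenMA.radial Ω w z ^ ((n : ℝ) + k + 1)) ^
        (1 / ((n : ℝ) + k + 1)) ≠ ⊤ := fun w hw =>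
    ENNReal.rpow_ne_top_of_nonneg hd0
      (GenMA.C0.lintegral_radial_rpow_lt_top hn hΩ hw (by linarith)).ne
  rw [GenMA.C0.normH_eq hn hΩ (GenMA.C0.add hΩ hu hv) hk, GenMA.C0.normH_eq hn hΩ hu hk,
    GenMA.C0.normH_eq hn hΩ hv hk, ← mul_add, ← ENNReal.toReal_add (hfin u hu) (hfin v hv)]
  refine mul_le_mul_of_nonneg_left (ENNReal.toReal_mono
    (ENNReal.add_ne_top.2 ⟨hfin u hu, hfin v hv⟩) ?_) (by positivity)
  refine le_trans ?_ (ENNReal.lintegral_Lp_add_le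
    (GenMA.measurable_radial Ω u).aemeasurable (GenMA.measurable_radial Ω v).aemeasurable hd)
  exact ENNReal.rpow_le_rpow (MeasureTheory.lintegral_mono fun z =>
    ENNReal.rpow_le_rpow (GenMA.radial_add_le hn hΩ hu hv z) (by linarith)) hd0
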